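/- Let $T$ be a finitary monad on $\mathsf{Set}$ with unit $\eta$, and let $F:\mathsf{Set}^T\to\mathsf{Set}^T$ be a finitary endofunctor (i.e. it preserves filtered colimits) on the category of Eilenberg–Moore algebras of $T$ that preserves surjective $T$-algebra morphisms. Let $\mathsf{Coalg}\,F$ be the category of all $F$-coalgebras and let $\mathsf{Coalg}_{\mathrm{ffg}}\,F$ be its full subcategory of coalgebras $c:TX\to FTX$ whose carrier is the free $T$-algebra on a finite set $X$. Elements $z\in Z$ and $w\in W$ of $F$-coalgebras $(Z,c)$ and $(W,d)$ are called behaviourally equivalent if there are an $F$-coalgebra $E$ and coalgebra morphisms $f:Z\to E$, $g:W\to E$ with $f(z)=g(w)$. A zig-zag $Z_0\xrightarrow{f_0}Z_1\xleftarrow{f_1}Z_2\xrightarrow{f_2}\cdots\xleftarrow{f_{n-1}}Z_n$ in $\mathsf{Coalg}_{\mathrm{ffg}}\,F$ relates $z_0\in Z_0$ and $z_n\in Z_n$ if there are $z_i\in Z_i$ for $0<i<n$ such that every arrow of the zig-zag maps the chosen element of its domain to the chosen element of its codomain. The functor $F$ is called proper if for all coalgebras $c:TX\to FTX$ and $d:TY\to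 FTY$ in $\mathsf{Coalg}_{\mathrm{ffg}}\,F$ and all $x\in X$, $y\in Y$ such that $\eta_X(x)$ and $\eta_Y(y)$ are behaviourally equivalent, some zig-zag in $\mathsf{Coalg}_{\mathrm{ffg}}\,F$ from $(TX,c)$ to $(TY,d)$ relates $\eta_X(x)$ and $\eta_Y(y)$. Then the colimit $\varphi F=\operatorname{colim}(\mathsf{Coalg}_{\mathrm{ffg}}\,F\hookrightarrow\mathsf{Coalg}\,F)$ and the final $F$-coalgebra $\nu F$ exist, and $F$ is proper if and only if the unique $F$-coalgebra morphism $m:\varphi F\to\nu F$ is a monomorphism in $\mathsf{Set}^T$ (i.e. $\varphi F$ is a subcoalgebra of $\nu F$). -/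

import Mathlib

open CategoryTheory CategoryTheory.Limits

universe v w u

/-- A zig-zag `Z₀ ⟶ Z₁ ⟵ Z₂ ⟶ Z₃ ⟵ ⋯ ⟶ Zₙ₋₁ ⟵ Zₙ` in a category, as a list of cospans.
`ZigZag Z W` is the type of zig-zags from `Z₀ = Z` to `Zₙ = W`. -/
inductive ZigZag {C : Type w} [Category.{v} C] : C → C → Type (max v w)
  /-- the zig-zag of length `0` -/
  | nil (Z : C) : ZigZag Z Z
  /-- prolong a zig-zag from `Z₂` by a cospan `Z₀ ⟶ Z₁ ⟵ Z₂` -/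
  | cons {Z₀ Z₁ Z₂ W : C} (f : Z₀ ⟶ Z₁) (g : Z₂ ⟶ Z₁) (p : ZigZag Z₂ W) : ZigZag Z₀ W

/-- The zig-zag, in a category with underlying sets given by `U`, relates `z₀` and `zₙ`: there are
elements `zᵢ` of the intermediate objects such that every arrow `Zᵢ ⟶ Zⱼ` of the zig-zag
maps `zᵢ` to `zⱼ`. -/
def ZigZag.Relates {C : Type w} [Category.{v} C] (U : C ⥤ Type u) :
    {Z W : C} → ZigZag Z W → U.obj Z → U.obj W → Prop
  | _, _, .nil _, z, z' => z = z'
  | _, _, .cons (Z₁ := Z₁) (Z₂ := Z₂) f g p, z₀, z' =>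
      ∃ (z₁ : U.obj Z₁) (z₂ : U.obj Z₂), U.map f z₀ = z₁ ∧ U.map g z₂ = z₁ ∧ p.Relates U z₂ z'

namespace AlgebraicCoalgebra

variable {T : Monad (Type u)}

/-- The endofunctor `F` of `Set^T` preserves surjective `T`-algebra morphisms. -/
def PreservesSurjections (F : T.Algebra ⥤ T.Algebra) : Prop :=
  ∀ ⦃A B : T.Algebra⦄ (q : A ⟶ B), Function.Surjective q.f → Function.Surjective (F.map q).f

/-- Elements `x`, `y` of two `F`-coalgebras are behaviourally equivalent if they are identified by
a pair of coalgebra morphisms into some `F`-coalgebra. -/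
def BehaviourallyEquivalent {F : T.Algebra ⥤ T.Algebra} {c d : Endofunctor.Coalgebra F}
    (x : c.V.A) (y : d.V.A) : Prop :=
  ∃ (e : Endofunctor.Coalgebra F) (f : c ⟶ e) (g : d ⟶ e), f.f.f x = g.f.f y

/-- An `F`-coalgebra `c : TX ⟶ F(TX)` carried by the free `T`-algebra on a finite set `X`. -/
structure FfgCoalgebra (F : T.Algebra ⥤ T.Algebra) where
  /-- the set of generators -/
  X : Type u
  finite : Finite X
  /-- the coalgebra structure -/
  str : T.free.obj X ⟶ F.obj (T.free.obj X)

/-- The underlying `F`-coalgebra. -/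
def FfgCoalgebra.toCoalgebra {F : T.Algebra ⥤ T.Algebra} (c : FfgCoalgebra F) :
    Endofunctor.Coalgebra F where
  V := T.free.obj c.X
  str := c.str

/-- The full subcategory of the category of all `F`-coalgebras given by the coalgebras
that are carried by free finitely generated `T`-algebras. -/
abbrev CoalgFfg (F : T.Algebra ⥤ T.Algebra) : Type (u + 1) :=
  InducedCategory (Endofunctor.Coalgebra F) (FfgCoalgebra.toCoalgebra (F := F))

/-- The inclusion of the category of coalgebras with free finitely generated carrier. -/
abbrev ffgInclusion (F : T.Algebra ⥤ T.Algebra) : CoalgFfg F ⥤ Endofunctor.Coalgebra F :=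
  inducedFunctor FfgCoalgebra.toCoalgebra

/-- The underlying set of a coalgebra with free finitely generated carrier. -/
abbrev ffgForget (F : T.Algebra ⥤ T.Algebra) : CoalgFfg F ⥤ Type u :=
  ffgInclusion F ⋙ Endofunctor.Coalgebra.forget F ⋙ T.forget

/-- The generator `x ∈ X` as the element `η_X(x)` of the carrier `TX`. -/
def generator {F : T.Algebra ⥤ T.Algebra} (c : FfgCoalgebra F) (x : c.X) : c.toCoalgebra.V.A :=
  T.η.app c.X x

/-- `F` is proper: behaviourally equivalent generators of coalgebras with free finitely generated
carriers are related by a zig-zag of such coalgebras. -/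
def IsProper (F : T.Algebra ⥤ T.Algebra) : Prop :=
  ∀ (c d : CoalgFfg F) (x : FfgCoalgebra.X c) (y : FfgCoalgebra.X d),
    BehaviourallyEquivalent (generator c x) (generator d y) →
      ∃ p : ZigZag c d, p.Relates (ffgForget F) (generator c x) (generator d y)

end AlgebraicCoalgebra

/-!
# Proper functors and the colimit of the free finitely generated coalgebras

Let `φF` be the colimit of the coalgebras carried by free algebras on finite sets, and `νF` the final
coalgebra. The comparison `m : φF ⟶ νF` identifies two elements coming from `TX` and `TY` exactly if
they are behaviourally equivalent. If the underlying set of `φF` is the colimit of the underlying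
sets `TX`, then two such elements are equal in `φF` exactly if a zig-zag relates them
(`ZigZag.exists_relates`, `ZigZag.Relates.ι_eq`). So injectivity of `m`, which is the same as being a
monomorphism of algebras, says that behavioural
equivalence of arbitrary elements of the `TX` is witnessed by zig-zags, while properness says
this for generators only. The gap is closed by `adjoin`: given `z` in `TX`, the coalgebra structure
extends to `T(X + 1)` so that the retraction sending the new generator to `z` is a morphism of
coalgebras.

That `φF` is computed on underlying sets rests on siftedness. The category of the coalgebras
concerned has finite coproducts, because `TX + TY = T(X + Y)`, hence is sifted, and it is essentially
small. Colimits of coalgebras are formed on carriers (`isColimitCoalgebraCocone`), and the forgetful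
functor from algebras creates the colimits that `T` preserves. A finitary `T` preserves sifted
colimits (`preservesColimitsOfShape_of_isSifted`), since an element of `T E` is a finite tuple in `E`
substituted into an element of some `T K` with `K` finite, and sifted colimits commute with finite
powers.

For the final coalgebra, the category of algebras is cocomplete (`hasColimits_algebra`): a colimit is
the quotient of a free algebra by the pairs that all cocones identify. So the category of coalgebras
is cocomplete, and by Freyd's criterion a weakly final coalgebra suffices. Since `F` preserves
surjections, every element of a coalgebra is in the image of one carried by a free algebra on
countably many generators (`exists_countableCoalgebra_hom`), and these form a small family. The
coproduct of this family, with all behaviourally equivalent elements identified by a wide pushout, is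
weakly final (`exists_weakly_terminal`).
-/

namespace AlgebraicCoalgebra

/-! ### Finitary functors between sets and sifted colimits -/

section Finitary

/-- The directed diagram of the finite subsets of a set. -/
def finsetDiagram (X : Type u) : Finset X ⥤ Type u where
  obj S := {x // x ∈ S}
  map f := ↾fun x => ⟨x.1, leOfHom f x.2⟩

/-- The inclusions of the finite subsets of `X` into `X`. -/
def finsetCocone (X : Type u) : Cocone (finsetDiagram X) where
  pt := X
  ι := { app := fun _ => ↾Subtype.val }

/-- Every set is the directed union of its finite subsets. -/
noncomputable def isColimitFinsetCocone (X : Type u) : IsColimit (finsetCocone X) := by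
  classical
  refine Types.FilteredColimit.isColimitOf _ _ (fun x => ⟨{x}, ⟨x, Finset.mem_singleton_self x⟩, rfl⟩) ?_
  intro S S' x y h
  exact ⟨S ∪ S', homOfLE Finset.subset_union_left, homOfLE Finset.subset_union_right,
    Subtype.ext h⟩

instance isFiltered_finset (X : Type u) : IsFiltered (Finset X) := by
  classical
  infer_instance

variable (G : Type u ⥤ Type u) [PreservesFilteredColimits G]

/-- A finitary functor preserves the directed union of finite subsets. -/
noncomputable def isColimitMapFinsetCocone (X : Type u) :
    IsColimit (G.mapCocone (finsetCocone X)) :=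
  have : PreservesColimitsOfShape (Finset X) G :=
    PreservesFilteredColimitsOfSize.preserves_filtered_colimits _
  isColimitOfPreserves G (isColimitFinsetCocone X)

/-- An element of `G X`, for `G` finitary, only involves finitely many elements of `X`. -/
theorem exists_finset_map_eq {X : Type u} (t : G.obj X) :
    ∃ (S : Finset X) (s : G.obj {x // x ∈ S}), G.map (↾Subtype.val) s = t :=
  Types.jointly_surjective_of_isColimit (isColimitMapFinsetCocone G X) t

/-- An equation in `G X` between elements supported on a finite set already holds in `G S` for some
finite subset `S` of `X`. -/
theorem exists_finset_map_eq_map {X A : Type u} [Finite A] (f : A → X) (a : G.obj A)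
    {B : Type u} [Finite B] (g : B → X) (b : G.obj B)
    (h : G.map (↾f) a = G.map (↾g) b) :
    ∃ (S : Finset X) (f' : A → {x // x ∈ S}) (g' : B → {x // x ∈ S}),
      (∀ x, (f' x).1 = f x) ∧ (∀ x, (g' x).1 = g x) ∧ G.map (↾f') a = G.map (↾g') b := by
  classical
  have := Fintype.ofFinite A
  have := Fintype.ofFinite B
  let S₁ := Finset.univ.image f
  let S₂ := Finset.univ.image g
  let f₁ : A → {x // x ∈ S₁} := fun x => ⟨f x, by simp [S₁]⟩
  let g₁ : B → {x // x ∈ S₂} := fun x => ⟨g x, by simp [S₂]⟩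
  have h' : (G.mapCocone (finsetCocone X)).ι.app S₁ (G.map (↾f₁) a) =
      (G.mapCocone (finsetCocone X)).ι.app S₂ (G.map (↾g₁) b) := by
    refine (ConcreteCategory.congr_hom (G.map_comp (↾f₁) (↾Subtype.val)) a).symm.trans
      (h.trans (ConcreteCategory.congr_hom (G.map_comp (↾g₁) (↾Subtype.val)) b))
  obtain ⟨S, i, j, e⟩ := (Types.FilteredColimit.isColimit_eq_iff _
    (isColimitMapFinsetCocone G X)).1 h'
  refine ⟨S, fun x => ⟨f x, leOfHom i (f₁ x).2⟩, fun x => ⟨g x, leOfHom j (g₁ x).2⟩,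
    fun _ => rfl, fun _ => rfl, ?_⟩
  exact (ConcreteCategory.congr_hom (G.map_comp (↾f₁) ((finsetDiagram X).map i)) a).trans
    (e.trans (ConcreteCategory.congr_hom (G.map_comp (↾g₁) ((finsetDiagram X).map j)) b).symm)

end Finitary

section Sifted

variable {J : Type u} [SmallCategory J] (D : J ⥤ Type u) (K : Type u)

/-- The power `j ↦ D(j)^K` of a diagram of sets. -/
def powerDiagram : J ⥤ Type u where
  obj j := K → D.obj j
  map f := ↾fun p k => D.map f (p k)

/-- The projection `D^K ⟶ D` at `k`. -/
def powerProj (k : K) : powerDiagram D K ⟶ D where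
  app j := ↾fun p => p k

/-- The pointwise power is the product in the category of diagrams. -/
def isLimitPowerFan : IsLimit (Fan.mk (powerDiagram D K) (powerProj D K)) :=
  Fan.IsLimit.mk _
    (fun s =>
      { app := fun j => ↾fun x k => (s.proj k).app j x
        naturality := fun i j f => by
          ext x
          funext k
          exact ConcreteCategory.congr_hom ((s.proj k).naturality f) x })
    (fun s k => rfl)
    (fun s m h => by
      ext j x
      funext k
      exact ConcreteCategory.congr_hom (NatTrans.congr_app (h k) j) x)

variable [IsSifted J] [Finite K]

/-- Sifted colimits commute with finite powers. -/
theorem power_bijective :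
    Function.Bijective (fun (x : (colimit (powerDiagram D K) : Type u)) (k : K) =>
      colim.map (powerProj D K k) x) := by
  have h := isLimitFanMkObjOfIsLimit colim _ _ (isLimitPowerFan D K)
  let t : Fan (fun _ : K => colimit D) :=
    Fan.mk (K → (colimit D : Type u)) (fun k => ↾fun x => x k)
  let e := h.lift t
  have he : ∀ k x, colim.map (powerProj D K k) (e x) = x k :=
    fun k x => ConcreteCategory.congr_hom (h.fac t ⟨k⟩) x
  constructor
  · intro x y hxy
    exact Concrete.isLimit_ext _ h x y (fun k => congrFun hxy k.as)
  · intro x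
    exact ⟨e x, funext fun k => he k x⟩

variable {D K}

/-- In a sifted colimit, a finite family of equations between `p` and `p'` in the colimit of `D`
comes from one equation in the colimit of the powers of `D`. -/
theorem ι_power_eq {c c' : J} (p : K → D.obj c) (p' : K → D.obj c')
    (h : ∀ k, colimit.ι D c (p k) = colimit.ι D c' (p' k)) :
    colimit.ι (powerDiagram D K) c p = colimit.ι (powerDiagram D K) c' p' := by
  refine (power_bijective D K).1 (funext fun k => ?_)
  refine (ConcreteCategory.congr_hom (colimit.ι_map (powerProj D K k) c) p).trans
    (Eq.trans ?_ (ConcreteCategory.congr_hom (colimit.ι_map (powerProj D K k) c') p').symm)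
  exact h k

/-- In a sifted colimit, finitely many elements come from a single stage of the diagram. -/
theorem exists_ι_power_eq (e : K → (colimit D : Type u)) :
    ∃ (c : J) (p : K → D.obj c), ∀ k, colimit.ι D c (p k) = e k := by
  obtain ⟨x, hx⟩ := (power_bijective D K).2 e
  obtain ⟨c, p, rfl⟩ := Types.jointly_surjective' x
  refine ⟨c, p, fun k => ?_⟩
  rw [← congrFun hx k]
  exact (ConcreteCategory.congr_hom (colimit.ι_map (powerProj D K k) c) p).symm

/-- The elements of `G (D j)` obtained by substituting the entries of a tuple into `t`. -/
def powerEval (G : Type u ⥤ Type u) (t : G.obj K) : powerDiagram D K ⟶ D ⋙ G where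
  app j := ↾fun p => G.map (↾p) t
  naturality i j f := by
    ext p
    exact ConcreteCategory.congr_hom (G.map_comp (↾p) (D.map f)) t

theorem ιColimitType_map_eq (G : Type u ⥤ Type u) {c c' : J} (p : K → D.obj c)
    (p' : K → D.obj c') (h : ∀ k, colimit.ι D c (p k) = colimit.ι D c' (p' k)) (t : G.obj K) :
    (D ⋙ G).ιColimitType c (G.map (↾p) t) = (D ⋙ G).ιColimitType c' (G.map (↾p') t) := by
  rw [← (Types.colimitEquivColimitType (D ⋙ G)).symm.injective.eq_iff]
  refine (Types.colimitEquivColimitType_symm_apply (D ⋙ G) c _).trans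
    (Eq.trans ?_ (Types.colimitEquivColimitType_symm_apply (D ⋙ G) c' _).symm)
  refine (ConcreteCategory.congr_hom (colimit.ι_map (powerEval G t) c) p).symm.trans
    (Eq.trans ?_ (ConcreteCategory.congr_hom (colimit.ι_map (powerEval G t) c') p'))
  exact congrArg (colim.map (powerEval G t)) (ι_power_eq p p' h)

end Sifted

/-- Finitary endofunctors of the category of sets preserve sifted colimits: an element of `G X` is
given by a finite tuple in `X` substituted into an element of `G K` with `K` finite, and sifted
colimits commute with the formation of finite tuples. -/
theorem preservesColimitsOfShape_of_isSifted (G : Type u ⥤ Type u) [PreservesFilteredColimits G]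
    (J : Type u) [SmallCategory J] [IsSifted J] : PreservesColimitsOfShape J G where
  preservesColimit {D} := by
    refine preservesColimit_of_preserves_colimit_cocone (colimit.isColimit D)
      (Nonempty.some ((Types.isColimit_iff_coconeTypesIsColimit _).2 ⟨⟨?_, ?_⟩⟩))
    · intro x y hxy
      obtain ⟨c, s, rfl⟩ := (D ⋙ G).ιColimitType_jointly_surjective x
      obtain ⟨c', s', rfl⟩ := (D ⋙ G).ιColimitType_jointly_surjective y
      replace hxy : G.map (colimit.ι D c) s = G.map (colimit.ι D c') s' := hxy
      obtain ⟨A, a, rfl⟩ := exists_finset_map_eq G s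
      obtain ⟨B, b, rfl⟩ := exists_finset_map_eq G s'
      obtain ⟨S, f, g, hf, hg, e⟩ := exists_finset_map_eq_map G
        (fun x : {x // x ∈ A} => colimit.ι D c x.1) a (fun x : {x // x ∈ B} => colimit.ι D c' x.1) b
        ((ConcreteCategory.congr_hom (G.map_comp (↾Subtype.val) (colimit.ι D c)) a).trans
          (hxy.trans (ConcreteCategory.congr_hom
            (G.map_comp (↾Subtype.val) (colimit.ι D c')) b).symm))
      -- all representatives are moved to a common stage, where they factor through `S`
      obtain ⟨d, p, hp⟩ := exists_ι_power_eq (D := D) (fun x : {x // x ∈ S} => x.1)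
      rw [ιColimitType_map_eq G (p' := fun x => p (f x)) (c' := d)
          (h := fun k => ((hp _).trans (hf k)).symm),
        ιColimitType_map_eq G (p' := fun x => p (g x)) (c' := d)
          (h := fun k => ((hp _).trans (hg k)).symm)]
      refine congrArg _ ((ConcreteCategory.congr_hom (G.map_comp (↾f) (↾p)) a).trans
        (Eq.trans ?_ (ConcreteCategory.congr_hom (G.map_comp (↾g) (↾p)) b).symm))
      exact congrArg _ e
    · intro x
      obtain ⟨S, s, rfl⟩ := exists_finset_map_eq G x
      obtain ⟨c, p, hp⟩ := exists_ι_power_eq (D := D) (fun x : {x // x ∈ S} => x.1)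
      refine ⟨(D ⋙ G).ιColimitType c (G.map (↾p) s), ?_⟩
      refine (ConcreteCategory.congr_hom (G.map_comp (↾p) (colimit.ι D c)) s).symm.trans ?_
      refine ConcreteCategory.congr_hom (congrArg G.map ?_) s
      ext k
      exact hp k

/-! ### Algebras for a monad on the category of sets -/

section Algebras

variable {T : Monad (Type u)}

theorem map_surjective (G : Type u ⥤ Type u) {X Y : Type u} {f : X ⟶ Y}
    (hf : Function.Surjective f) : Function.Surjective (G.map f) := by
  have : Epi f := (epi_iff_surjective f).2 hf
  have : IsSplitEpi f := isSplitEpi_of_epi f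
  exact (epi_iff_surjective (G.map f)).1 inferInstance

theorem hom_map_a {A B : T.Algebra} (f : A ⟶ B) (t : T.obj A.A) :
    B.a (T.map f.f t) = f.f (A.a t) :=
  ConcreteCategory.congr_hom f.h t

theorem a_map_η (A : T.Algebra) (x : A.A) : A.a (T.η.app A.A x) = x :=
  ConcreteCategory.congr_hom A.unit x

theorem a_μ (A : T.Algebra) (t : T.obj (T.obj A.A)) :
    A.a (T.μ.app A.A t) = A.a (T.map A.a t) :=
  ConcreteCategory.congr_hom A.assoc t

theorem algebra_hom_ext {A B : T.Algebra} {f g : A ⟶ B} (h : ∀ x, f.f x = g.f x) : f = g :=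
  Monad.Algebra.Hom.ext (by ext x; exact h x)

/-- A map `k` is a homomorphism if it becomes one after composing with a surjective
homomorphism `e`. -/
def homOfSurjective {A B C : T.Algebra} (e : A ⟶ B) (he : Function.Surjective e.f) (g : A ⟶ C)
    (k : B.A → C.A) (hk : ∀ x, k (e.f x) = g.f x) : B ⟶ C where
  f := ↾k
  h := by
    ext t
    obtain ⟨t, rfl⟩ := map_surjective T.toFunctor he t
    have hk' : e.f ≫ ↾k = g.f := by ext x; exact hk x
    change C.a (T.map (↾k) (T.map e.f t)) = k (B.a (T.map e.f t))
    rw [hom_map_a, hk, ← hom_map_a, ← hk', T.map_comp]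
    rfl

/-- A map that is constant on the fibres of a surjective homomorphism `e` factors through `e`. -/
theorem exists_algebra_factorization {A B C : T.Algebra} (e : A ⟶ B)
    (he : Function.Surjective e.f) (g : A ⟶ C) (h : ∀ x y, e.f x = e.f y → g.f x = g.f y) :
    ∃ k : B ⟶ C, e ≫ k = g := by
  have hk : ∀ x, g.f (Function.surjInv he (e.f x)) = g.f x :=
    fun x => h _ _ (Function.surjInv_eq he _)
  exact ⟨homOfSurjective e he g (fun y => g.f (Function.surjInv he y)) hk, algebra_hom_ext hk⟩

/-- The homomorphism out of a free algebra that extends a map of generators. -/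
def freeLift {X : Type u} {A : T.Algebra} (g : X → A.A) : T.free.obj X ⟶ A :=
  (T.adj.homEquiv X A).symm (↾g)

theorem freeLift_η {X : Type u} {A : T.Algebra} (g : X → A.A) (x : X) :
    (freeLift g).f (T.η.app X x) = g x :=
  ConcreteCategory.congr_hom ((T.adj.homEquiv X A).apply_symm_apply (↾g)) x

theorem free_hom_ext {X : Type u} {A : T.Algebra} {f g : T.free.obj X ⟶ A}
    (h : ∀ x, f.f (T.η.app X x) = g.f (T.η.app X x)) : f = g :=
  (T.adj.homEquiv X A).injective (by ext x; exact h x)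

theorem free_map_η {X Y : Type u} (f : X ⟶ Y) (x : X) :
    (T.free.map f).f (T.η.app X x) = T.η.app Y (f x) :=
  (ConcreteCategory.congr_hom (T.η.naturality f) x).symm

theorem free_map_freeLift {X Y : Type u} {A : T.Algebra} (f : X → Y) (g : Y → A.A) :
    T.free.map (↾f) ≫ freeLift g = freeLift (fun x => g (f x)) := by
  refine free_hom_ext fun x => ?_
  rw [freeLift_η]
  exact (congrArg (freeLift g).f (free_map_η _ x)).trans (freeLift_η _ _)

section Quotient

variable (A : T.Algebra) (r : Setoid A.A)

/-- The quotient map of a setoid on the carrier of an algebra. -/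
def quotMap : A.A ⟶ Quotient r := ↾Quotient.mk r

theorem quotMap_surjective : Function.Surjective (quotMap A r) := Quotient.mk_surjective

/-- A setoid is a congruence if its quotient map `q` makes `q ∘ a` constant on the fibres of `T q`,
that is, if the structure map `a` descends to the quotient. -/
def IsCongruence : Prop :=
  ∀ s t : T.obj A.A, T.map (quotMap A r) s = T.map (quotMap A r) t → r (A.a s) (A.a t)

variable {A r} (hr : IsCongruence A r)

/-- The structure map of the quotient of an algebra by a congruence, defined by choosing preimages
under `T q`. -/
noncomputable def quotStr : T.obj (Quotient r) → Quotient r :=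
  fun t => Quotient.mk r (A.a (Function.surjInv
    (map_surjective T.toFunctor (quotMap_surjective A r)) t))

theorem quotStr_map (hr : IsCongruence A r) (t : T.obj A.A) :
    quotStr (T.map (quotMap A r) t) = quotMap A r (A.a t) :=
  Quotient.sound (hr _ _ (Function.surjInv_eq
    (map_surjective T.toFunctor (quotMap_surjective A r)) _))

/-- The quotient of an algebra by a congruence. -/
noncomputable def quotAlgebra : T.Algebra where
  A := Quotient r
  a := ↾quotStr
  unit := by
    ext x
    obtain ⟨x, rfl⟩ := quotMap_surjective A r x
    have e := ConcreteCategory.congr_hom (T.η.naturality (quotMap A r)) x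
    change quotStr (T.η.app _ (quotMap A r x)) = quotMap A r x
    refine (congrArg quotStr e).trans ((quotStr_map hr _).trans ?_)
    exact congrArg _ (a_map_η A x)
  assoc := by
    ext t
    obtain ⟨t, rfl⟩ := map_surjective T.toFunctor
      (map_surjective T.toFunctor (quotMap_surjective A r)) t
    have e := ConcreteCategory.congr_hom (T.μ.naturality (quotMap A r)) t
    have e' : T.map (quotMap A r) ≫ ↾quotStr = A.a ≫ quotMap A r := by
      ext t
      exact quotStr_map hr t
    change quotStr (T.μ.app _ (T.map (T.map (quotMap A r)) t)) =
      quotStr (T.map (↾quotStr) (T.map (T.map (quotMap A r)) t))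
    refine (congrArg quotStr e).trans ((quotStr_map hr _).trans ?_)
    have e₂ : T.map (↾quotStr) (T.map (T.map (quotMap A r)) t) =
        T.map (quotMap A r) (T.map A.a t) := by
      refine (ConcreteCategory.congr_hom (T.map_comp (T.map (quotMap A r)) (↾quotStr)) t).symm.trans
        ((ConcreteCategory.congr_hom (congrArg T.map e') t).trans
          (ConcreteCategory.congr_hom (T.map_comp A.a (quotMap A r)) t))
    rw [e₂]
    refine Eq.trans ?_ (quotStr_map hr _).symm
    exact congrArg _ (a_μ A t)

/-- The quotient homomorphism. -/
noncomputable def quotHom : A ⟶ quotAlgebra hr where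
  f := quotMap A r
  h := by
    ext t
    exact quotStr_map hr t

end Quotient

section Colimits

variable {J : Type u} [SmallCategory J] (D : J ⥤ T.Algebra)

/-- The free algebra on the disjoint union of the carriers of a diagram. -/
abbrev sumAlgebra : T.Algebra := T.free.obj (Σ j, (D.obj j).A)

/-- The homomorphism out of `sumAlgebra D` induced by a cocone. -/
def sumDesc (s : Cocone D) : sumAlgebra D ⟶ s.pt := freeLift fun x => (s.ι.app x.1).f x.2

/-- Two elements are identified if every cocone identifies them. The cocones form a large
collection, which is harmless as they are only quantified over in a proposition. -/
def coconeSetoid : Setoid (sumAlgebra D).A where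
  r x y := ∀ s : Cocone D, (sumDesc D s).f x = (sumDesc D s).f y
  iseqv := ⟨fun _ _ => rfl, fun h s => (h s).symm, fun h h' s => (h s).trans (h' s)⟩

theorem isCongruence_coconeSetoid : IsCongruence (sumAlgebra D) (coconeSetoid D) := by
  intro x y h s
  let k : Quotient (coconeSetoid D) → s.pt.A :=
    Quotient.lift (sumDesc D s).f (fun _ _ h => h s)
  have hk : quotMap _ (coconeSetoid D) ≫ ↾k = (sumDesc D s).f := rfl
  have e : ∀ x, T.map (sumDesc D s).f x = T.map (↾k) (T.map (quotMap _ (coconeSetoid D)) x) := by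
    intro x
    rw [← hk, T.map_comp]
    rfl
  rw [← hom_map_a, ← hom_map_a, e, e, h]

/-- The elements of the diagram as elements of the quotient. -/
def coconeInj (j : J) (x : (D.obj j).A) : Quotient (coconeSetoid D) :=
  quotMap _ _ (T.η.app _ (⟨j, x⟩ : Σ j, (D.obj j).A))

theorem sumDesc_η (s : Cocone D) (j : J) (x : (D.obj j).A) :
    (sumDesc D s).f (T.η.app _ (⟨j, x⟩ : Σ j, (D.obj j).A)) = (s.ι.app j).f x :=
  freeLift_η _ _

/-- The canonical homomorphism from the free algebra on the carrier of `A` onto `A`. -/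
def counitHom (A : T.Algebra) : T.free.obj A.A ⟶ A := freeLift fun x => x

theorem counitHom_surjective (A : T.Algebra) : Function.Surjective (counitHom A).f :=
  fun x => ⟨T.η.app A.A x, freeLift_η _ x⟩

theorem coconeInj_counitHom (j : J) (x : (T.free.obj (D.obj j).A).A) :
    coconeInj D j ((counitHom (D.obj j)).f x) =
      (T.free.map (↾Sigma.mk (β := fun j => (D.obj j).A) j) ≫
        quotHom (isCongruence_coconeSetoid D)).f x := by
  refine Quotient.sound (fun s => ?_)
  rw [sumDesc_η]
  have e : counitHom (D.obj j) ≫ s.ι.app j =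
      T.free.map (↾Sigma.mk (β := fun j => (D.obj j).A) j) ≫ sumDesc D s := by
    refine free_hom_ext fun y => ?_
    refine Eq.trans (congrArg (s.ι.app j).f (freeLift_η _ y)) (Eq.symm ?_)
    refine (congrArg (sumDesc D s).f (free_map_η _ y)).trans ?_
    exact sumDesc_η D s j y
  exact ConcreteCategory.congr_hom (congrArg Monad.Algebra.Hom.f e) x

/-- The colimit cocone of a diagram of algebras. -/
noncomputable def algebraCocone : Cocone D where
  pt := quotAlgebra (isCongruence_coconeSetoid D)
  ι :=
    { app := fun j => homOfSurjective _ (counitHom_surjective _) _ _ (coconeInj_counitHom D j)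
      naturality := fun i j f => algebra_hom_ext fun x => Quotient.sound fun s => by
        rw [sumDesc_η, sumDesc_η]
        exact ConcreteCategory.congr_hom (congrArg Monad.Algebra.Hom.f (s.w f)) x }

theorem exists_quotHom_comp_eq (s : Cocone D) :
    ∃ k : (algebraCocone D).pt ⟶ s.pt, quotHom (isCongruence_coconeSetoid D) ≫ k = sumDesc D s :=
  exists_algebra_factorization _ (quotMap_surjective _ _) _
    fun _ _ h => (Quotient.exact h : coconeSetoid D _ _) s

/-- The quotient of the free algebra on the disjoint union by the pairs that all cocones identify is
the colimit. -/
noncomputable def isColimitAlgebraCocone : IsColimit (algebraCocone D) where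
  desc s := (exists_quotHom_comp_eq D s).choose
  fac s j := algebra_hom_ext fun x =>
    (ConcreteCategory.congr_hom (congrArg Monad.Algebra.Hom.f
      (exists_quotHom_comp_eq D s).choose_spec) _).trans (sumDesc_η D s j x)
  uniq s m hm := by
    have e : quotHom (isCongruence_coconeSetoid D) ≫ m = sumDesc D s :=
      free_hom_ext fun x => (ConcreteCategory.congr_hom
        (congrArg Monad.Algebra.Hom.f (hm x.1)) x.2).trans (sumDesc_η D s x.1 x.2).symm
    refine algebra_hom_ext fun x => ?_
    obtain ⟨x, rfl⟩ := quotMap_surjective _ _ x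
    exact ConcreteCategory.congr_hom (congrArg Monad.Algebra.Hom.f
      (e.trans (exists_quotHom_comp_eq D s).choose_spec.symm)) x

/-- The category of algebras for any monad on the category of sets is cocomplete. -/
instance hasColimits_algebra : HasColimitsOfSize.{u, u} T.Algebra where
  has_colimits_of_shape _ _ := { has_colimit := fun D => ⟨_, isColimitAlgebraCocone D⟩ }

end Colimits
end Algebras

/-! ### Colimits of coalgebras -/

section Coalgebras

universe v₁ u₁ v₂ u₂

variable {C : Type u₁} [Category.{v₁} C] {F : C ⥤ C} {J : Type u₂} [Category.{v₂} J]
  (K : J ⥤ Endofunctor.Coalgebra F) {t : Cocone (K ⋙ Endofunctor.Coalgebra.forget F)}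
  (ht : IsColimit t)

theorem coalgebra_comp_str_map {A B : Endofunctor.Coalgebra F} (k : A ⟶ B) {X : C}
    (g : B.V ⟶ X) (g' : A.V ⟶ X) (e : k.f ≫ g = g') :
    k.f ≫ B.str ≫ F.map g = A.str ≫ F.map g' := by
  rw [← e, F.map_comp, Endofunctor.Coalgebra.Hom.h_assoc]

/-- A leg `f` of a cocone of coalgebras, composed with a map `m` of carriers to a coalgebra `B`, is
compatible with the structures if the composite is. -/
theorem comp_coalgebra_square {A E B : Endofunctor.Coalgebra F} (f : A ⟶ E) (m : E.V ⟶ B.V)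
    (g : A ⟶ B) (e : f.f ≫ m = g.f) : f.f ≫ E.str ≫ F.map m = f.f ≫ m ≫ B.str := by
  rw [coalgebra_comp_str_map f m g.f e, g.h, ← e, Category.assoc]

/-- The cocone whose descent is the coalgebra structure on the colimit of the carriers. -/
def strCocone (t : Cocone (K ⋙ Endofunctor.Coalgebra.forget F)) :
    Cocone (K ⋙ Endofunctor.Coalgebra.forget F) where
  pt := F.obj t.pt
  ι :=
    { app := fun j => (K.obj j).str ≫ F.map (t.ι.app j)
      naturality := fun _ _ f =>
        (coalgebra_comp_str_map (K.map f) _ _ (t.w f)).trans (Category.comp_id _).symm }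

/-- The colimit of the carriers of a diagram of coalgebras, as a coalgebra. -/
def colimitCoalgebra : Endofunctor.Coalgebra F where
  V := t.pt
  str := ht.desc (strCocone K t)

theorem ι_colimitCoalgebra_str (j : J) :
    (t.ι.app j : (K.obj j).V ⟶ t.pt) ≫ (colimitCoalgebra K ht).str =
      (K.obj j).str ≫ F.map (t.ι.app j) :=
  ht.fac (strCocone K t) j

/-- The cocone of coalgebras over a colimit of carriers. -/
def coalgebraCocone : Cocone K where
  pt := colimitCoalgebra K ht
  ι :=
    { app := fun j => { f := t.ι.app j, h := (ι_colimitCoalgebra_str K ht j).symm }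
      naturality := fun _ _ f => Endofunctor.Coalgebra.ext (t.ι.naturality f) }

/-- Colimits of coalgebras are formed on carriers. -/
def isColimitCoalgebraCocone : IsColimit (coalgebraCocone K ht) where
  desc s :=
    { f := ht.desc ((Endofunctor.Coalgebra.forget F).mapCocone s)
      h := by
        refine ht.hom_ext fun j => ?_
        exact comp_coalgebra_square ((coalgebraCocone K ht).ι.app j) _ (s.ι.app j) (ht.fac _ j) }
  fac s j := Endofunctor.Coalgebra.ext (ht.fac _ j)
  uniq s m hm := Endofunctor.Coalgebra.ext
    (ht.uniq ((Endofunctor.Coalgebra.forget F).mapCocone s) m.f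
      fun j => congrArg Endofunctor.Coalgebra.Hom.f (hm j))

theorem hasColimit_coalgebra [HasColimit (K ⋙ Endofunctor.Coalgebra.forget F)] : HasColimit K :=
  ⟨_, isColimitCoalgebraCocone K (colimit.isColimit _)⟩

theorem preservesColimit_coalgebraForget [HasColimit (K ⋙ Endofunctor.Coalgebra.forget F)] :
    PreservesColimit K (Endofunctor.Coalgebra.forget F) :=
  preservesColimit_of_preserves_colimit_cocone
    (isColimitCoalgebraCocone K (colimit.isColimit _)) (colimit.isColimit _)

end Coalgebras

instance hasColimits_coalgebra {T : Monad (Type u)} (F : T.Algebra ⥤ T.Algebra) :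
    HasColimitsOfSize.{u, u} (Endofunctor.Coalgebra F) where
  has_colimits_of_shape _ _ := { has_colimit := fun K => hasColimit_coalgebra K }

/-! ### The category of coalgebras with free finitely generated carrier -/

section Ffg

variable {T : Monad (Type u)} (F : T.Algebra ⥤ T.Algebra)

/-- The coalgebras carried by the free algebras on the standard finite sets. -/
def standardFfg (p : Σ n : ℕ, (T.free.obj (ULift.{u} (Fin n)) ⟶
    F.obj (T.free.obj (ULift.{u} (Fin n))))) : CoalgFfg F :=
  { X := ULift.{u} (Fin p.1), finite := inferInstance, str := p.2 : FfgCoalgebra F }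

instance essentiallySmall_coalgFfg : EssentiallySmall.{u} (CoalgFfg F) := by
  refine (essentiallySmall_iff _).2 ⟨?_, inferInstance⟩
  refine small_of_surjective (f := fun p => toSkeleton (standardFfg F p)) fun s => ?_
  obtain ⟨c, rfl⟩ := Quotient.exists_rep s
  have := c.finite
  obtain ⟨n, ⟨e⟩⟩ := Finite.exists_equiv_fin c.X
  let i : ULift.{u} (Fin n) ≅ c.X := (Equiv.ulift.trans e.symm).toIso
  let i' := T.free.mapIso i
  refine ⟨⟨n, i'.hom ≫ c.str ≫ F.map i'.inv⟩, Quotient.sound ⟨InducedCategory.isoMk ?_⟩⟩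
  refine Endofunctor.Coalgebra.isoMk i' ?_
  change (i'.hom ≫ c.str ≫ F.map i'.inv) ≫ F.map i'.hom = i'.hom ≫ c.str
  simp [← F.map_comp]

variable {F}

/-- The copairing of two homomorphisms out of free algebras. -/
def copair {X Y : Type u} {A : T.Algebra} (f : T.free.obj X ⟶ A) (g : T.free.obj Y ⟶ A) :
    T.free.obj (X ⊕ Y) ⟶ A :=
  freeLift (Sum.elim (fun x => f.f (T.η.app X x)) (fun y => g.f (T.η.app Y y)))

theorem inl_copair {X Y : Type u} {A : T.Algebra} (f : T.free.obj X ⟶ A)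
    (g : T.free.obj Y ⟶ A) : T.free.map (↾Sum.inl) ≫ copair f g = f :=
  (free_map_freeLift _ _).trans (free_hom_ext fun x => freeLift_η _ x)

theorem inr_copair {X Y : Type u} {A : T.Algebra} (f : T.free.obj X ⟶ A)
    (g : T.free.obj Y ⟶ A) : T.free.map (↾Sum.inr) ≫ copair f g = g :=
  (free_map_freeLift _ _).trans (free_hom_ext fun x => freeLift_η _ x)

theorem free_sum_hom_ext {X Y : Type u} {A : T.Algebra} {f g : T.free.obj (X ⊕ Y) ⟶ A}
    (h₁ : T.free.map (↾Sum.inl) ≫ f = T.free.map (↾Sum.inl) ≫ g)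
    (h₂ : T.free.map (↾Sum.inr) ≫ f = T.free.map (↾Sum.inr) ≫ g) : f = g := by
  refine free_hom_ext fun x => ?_
  rcases x with x | x
  · have e := ConcreteCategory.congr_hom (congrArg Monad.Algebra.Hom.f h₁) (T.η.app X x)
    have e' := free_map_η (T := T) (↾(Sum.inl : X → X ⊕ Y)) x
    exact (congrArg f.f e').symm.trans (e.trans (congrArg g.f e'))
  · have e := ConcreteCategory.congr_hom (congrArg Monad.Algebra.Hom.f h₂) (T.η.app Y x)
    have e' := free_map_η (T := T) (↾(Sum.inr : Y → X ⊕ Y)) x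
    exact (congrArg f.f e').symm.trans (e.trans (congrArg g.f e'))

/-- The coproduct of two coalgebras with free finitely generated carrier is carried by the free
algebra on the disjoint union of the generators. -/
def ffgCoprod (c d : FfgCoalgebra F) : FfgCoalgebra F where
  X := c.X ⊕ d.X
  finite := by
    have := c.finite
    have := d.finite
    infer_instance
  str := copair (c.str ≫ F.map (T.free.map (↾Sum.inl))) (d.str ≫ F.map (T.free.map (↾Sum.inr)))

/-- The left injection of the coproduct. -/
def ffgInl (c d : FfgCoalgebra F) : c.toCoalgebra ⟶ (ffgCoprod c d).toCoalgebra where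
  f := T.free.map (↾Sum.inl)
  h := (inl_copair _ _).symm

/-- The right injection of the coproduct. -/
def ffgInr (c d : FfgCoalgebra F) : d.toCoalgebra ⟶ (ffgCoprod c d).toCoalgebra where
  f := T.free.map (↾Sum.inr)
  h := (inr_copair _ _).symm

/-- The copairing of morphisms of coalgebras. -/
def ffgDesc {c d : FfgCoalgebra F} {e : Endofunctor.Coalgebra F} (f : c.toCoalgebra ⟶ e)
    (g : d.toCoalgebra ⟶ e) : (ffgCoprod c d).toCoalgebra ⟶ e where
  f := copair f.f g.f
  h := by
    refine free_sum_hom_ext ?_ ?_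
    · exact comp_coalgebra_square (ffgInl c d) _ f (inl_copair _ _)
    · exact comp_coalgebra_square (ffgInr c d) _ g (inr_copair _ _)

instance hasBinaryCoproducts_coalgFfg : HasBinaryCoproducts (CoalgFfg F) := by
  have (c d : CoalgFfg F) : HasColimit (pair c d) :=
    ⟨BinaryCofan.mk (P := (ffgCoprod c d : CoalgFfg F))
      (InducedCategory.homMk (ffgInl c d)) (InducedCategory.homMk (ffgInr c d)),
      BinaryCofan.IsColimit.mk _ (fun f g => InducedCategory.homMk (ffgDesc f.hom g.hom))
        (fun f g => InducedCategory.hom_ext (Endofunctor.Coalgebra.ext (inl_copair _ _)))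
        (fun f g => InducedCategory.hom_ext (Endofunctor.Coalgebra.ext (inr_copair _ _)))
        (fun f g m h₁ h₂ => InducedCategory.hom_ext (Endofunctor.Coalgebra.ext
          (free_sum_hom_ext
            (((congrArg (fun m => m.hom.f) h₁)).trans (inl_copair _ _).symm)
            (((congrArg (fun m => m.hom.f) h₂)).trans (inr_copair _ _).symm))))⟩
  exact hasBinaryCoproducts_of_hasColimit_pair _

/-- The coalgebra carried by the free algebra on the empty set. -/
instance nonempty_coalgFfg : Nonempty (CoalgFfg F) :=
  ⟨standardFfg F ⟨0, freeLift fun x => x.down.elim0⟩⟩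

end Ffg

section Colimit

variable {T : Monad (Type u)} [PreservesFilteredColimits T.toFunctor]

theorem preservesColimitsOfShape_monad (J : Type w) [Category.{v} J] [EssentiallySmall.{u} J]
    [IsSifted J] : PreservesColimitsOfShape J T.toFunctor := by
  have : IsSifted (SmallModel.{u} J) := IsSifted.isSifted_of_equiv (equivSmallModel J).symm
  have := preservesColimitsOfShape_of_isSifted T.toFunctor (SmallModel.{u} J)
  exact preservesColimitsOfShape_of_equiv (equivSmallModel J).symm T.toFunctor

instance hasColimit_ffgInclusion (F : T.Algebra ⥤ T.Algebra) : HasColimit (ffgInclusion F) := by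
  have : HasColimitsOfShape (CoalgFfg F) (Endofunctor.Coalgebra F) :=
    hasColimitsOfShape_of_equivalence (equivSmallModel.{u} (CoalgFfg F)).symm
  infer_instance

/-- The underlying set of the colimit of all coalgebras with free finitely generated carrier is the
colimit of the underlying sets. -/
theorem preservesColimit_forget (F : T.Algebra ⥤ T.Algebra) :
    PreservesColimit (ffgInclusion F) (Endofunctor.Coalgebra.forget F ⋙ T.forget) := by
  have := preservesColimitsOfShape_monad (T := T) (CoalgFfg F)
  have : HasColimitsOfShape (CoalgFfg F) T.Algebra :=
    hasColimitsOfShape_of_equivalence (equivSmallModel.{u} (CoalgFfg F)).symm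
  have : HasColimitsOfShape (CoalgFfg F) (Type u) :=
    hasColimitsOfShape_of_equivalence (equivSmallModel.{u} (CoalgFfg F)).symm
  have := preservesColimit_coalgebraForget (ffgInclusion F)
  infer_instance

end Colimit

/-! ### The final coalgebra -/

section Terminal

theorem exists_countable_closed {Z : Type u} (S : Z → Finset Z) (z : Z) :
    ∃ Y : Set Z, Y.Countable ∧ z ∈ Y ∧ ∀ y ∈ Y, ∀ x ∈ S y, x ∈ Y := by
  let step : Set Z → Set Z := fun A => ⋃ y ∈ A, (S y : Set Z)
  refine ⟨⋃ n : ℕ, step^[n] {z}, Set.countable_iUnion fun n => ?_,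
    Set.mem_iUnion.2 ⟨0, rfl⟩, ?_⟩
  · induction n with
    | zero => exact Set.countable_singleton z
    | succ n ih =>
      rw [Function.iterate_succ_apply']
      exact ih.biUnion fun y _ => (S y).countable_toSet
  · intro y hy x hx
    obtain ⟨n, hn⟩ := Set.mem_iUnion.1 hy
    refine Set.mem_iUnion.2 ⟨n + 1, ?_⟩
    rw [Function.iterate_succ_apply']
    exact Set.mem_biUnion hn hx

variable {T : Monad (Type u)} (F : T.Algebra ⥤ T.Algebra)

/-- The coalgebras carried by free algebras on subsets of a fixed countable set. They form a small
family. -/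
def countableCoalgebra (p : Σ X : Set (ULift.{u} ℕ), (T.free.obj X ⟶ F.obj (T.free.obj X))) :
    Endofunctor.Coalgebra F where
  V := T.free.obj p.1
  str := p.2

variable {F}

/-- Every element of a coalgebra `Z` lies in the image of a coalgebra on countably many free
generators. The structure of `Z` lifts along the surjection `F (T Z) ⟶ F Z` to a map
`g : Z → F (T Z)`, each `g z` involves finitely many elements of `Z`, and a countable subset of `Z`
closed under passing from `z` to the elements involved in `g z` carries the required coalgebra. -/
theorem exists_countableCoalgebra_hom [PreservesFilteredColimits T.toFunctor]
    [PreservesFilteredColimits F] (hsurj : PreservesSurjections F) (Z : Endofunctor.Coalgebra F)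
    (z : Z.V.A) : ∃ p, ∃ (f : countableCoalgebra F p ⟶ Z) (y : (countableCoalgebra F p).V.A),
      f.f.f y = z := by
  let G : Type u ⥤ Type u := T.free ⋙ F ⋙ T.forget
  have : PreservesFilteredColimits G := by
    constructor
    intro J _ _
    have := PreservesFilteredColimitsOfSize.preserves_filtered_colimits (F := T.toFunctor) J
    have := PreservesFilteredColimitsOfSize.preserves_filtered_colimits (F := F) J
    have : PreservesColimitsOfShape J T.free := T.adj.leftAdjoint_preservesColimits.1
    infer_instance
  have hg : ∀ x : Z.V.A, ∃ (S : Finset Z.V.A) (s : G.obj {x // x ∈ S}),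
      (F.map (counitHom Z.V)).f (G.map (↾Subtype.val) s) = Z.str.f x := by
    intro x
    obtain ⟨t, ht⟩ := hsurj (counitHom Z.V) (counitHom_surjective _) (Z.str.f x)
    obtain ⟨S, s, rfl⟩ := exists_finset_map_eq G t
    exact ⟨S, s, ht⟩
  choose S s hs using hg
  obtain ⟨Y, hY, hz, hYS⟩ := exists_countable_closed S z
  obtain ⟨i, hi⟩ := hY.exists_injective_nat
  let X : Set (ULift.{u} ℕ) := Set.range fun y : Y => ULift.up (i y)
  let e : Y ≃ X := Equiv.ofInjective _ (ULift.up_injective.comp hi)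
  let j : X → Z.V.A := fun x => (e.symm x).1
  let incl : (x : X) → {y // y ∈ S (j x)} → X := fun x y => e ⟨y.1, hYS _ (e.symm x).2 _ y.2⟩
  have hincl : ∀ x y, j (incl x y) = y.1 := fun x y => by simp [j, incl]
  refine ⟨⟨X, freeLift fun x => G.map (↾incl x) (s (j x))⟩,
    { f := freeLift j, h := free_hom_ext fun x => ?_ }, T.η.app _ (e ⟨z, hz⟩), ?_⟩
  · have e₁ : T.free.map (↾incl x) ≫ freeLift j = T.free.map (↾Subtype.val) ≫ counitHom Z.V :=
      (free_map_freeLift _ _).trans (Eq.trans (by simp only [hincl]) (free_map_freeLift _ _).symm)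
    have e₂ := congrArg F.map e₁
    rw [F.map_comp, F.map_comp] at e₂
    have e₃ := ConcreteCategory.congr_hom (congrArg Monad.Algebra.Hom.f e₂) (s (j x))
    refine Eq.trans (congrArg (F.map (freeLift j)).f (freeLift_η _ x)) ?_
    refine (e₃.trans (hs (j x))).trans ?_
    exact congrArg Z.str.f (freeLift_η j x).symm
  · exact (freeLift_η j _).trans (by simp [j])

/-- A morphism of coalgebras that is constant on the fibres of a surjective morphism `e` factors
through `e`. -/
theorem exists_coalgebra_factorization {A B C : Endofunctor.Coalgebra F} (e : A ⟶ B)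
    (he : Function.Surjective e.f.f) (g : A ⟶ C)
    (h : ∀ x y, e.f.f x = e.f.f y → g.f.f x = g.f.f y) : Nonempty (B ⟶ C) := by
  obtain ⟨k, hk⟩ := exists_algebra_factorization e.f he g.f h
  have : Epi e.f.f := (epi_iff_surjective _).2 he
  have : Epi e.f := T.algebra_epi_of_epi e.f
  exact ⟨{ f := k, h := (cancel_epi e.f).1 (comp_coalgebra_square e k g hk) }⟩

/-- Let `M` be the coproduct of the countable coalgebras, and let `N` be the wide pushout of
morphisms out of `M` that identify all the pairs of elements of `M` which some morphism identifies.
Every coalgebra `Z` is a quotient `e` of a coproduct `W` of countable coalgebras, and the canonical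
morphism `W ⟶ M ⟶ N` factors through `e`, as the pushout of `e` along `W ⟶ M` shows. -/
theorem exists_weakly_terminal [PreservesFilteredColimits T.toFunctor]
    [PreservesFilteredColimits F] (hsurj : PreservesSurjections F) :
    ∃ N : Endofunctor.Coalgebra F, ∀ Z, Nonempty (Z ⟶ N) := by
  let M := ∐ countableCoalgebra F
  let I := {p : M.V.A × M.V.A // ∃ (E : Endofunctor.Coalgebra F) (h : M ⟶ E),
    h.f.f p.1 = h.f.f p.2}
  choose E h hE using fun i : I => i.2
  let q : M ⟶ widePushout M E h := WidePushout.head h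
  have hq : ∀ (a b : M.V.A) (E' : Endofunctor.Coalgebra F) (h' : M ⟶ E'),
      h'.f.f a = h'.f.f b → q.f.f a = q.f.f b := by
    intro a b E' h' hab
    let i : I := ⟨(a, b), E', h', hab⟩
    have e : h i ≫ WidePushout.ι h i = q := WidePushout.arrow_ι h i
    rw [← e]
    exact congrArg (WidePushout.ι h i).f.f (hE i)
  refine ⟨widePushout M E h, fun Z => ?_⟩
  let D : (Σ p, (countableCoalgebra F p ⟶ Z)) → Endofunctor.Coalgebra F :=
    fun i => countableCoalgebra F i.1
  let e : ∐ D ⟶ Z := Sigma.desc fun i => i.2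
  let g : ∐ D ⟶ M := Sigma.desc fun i => Sigma.ι (countableCoalgebra F) i.1
  refine exists_coalgebra_factorization e (fun z => ?_) (g ≫ q) (fun x y hxy => ?_)
  · obtain ⟨p, f, y, rfl⟩ := exists_countableCoalgebra_hom hsurj Z z
    refine ⟨(Sigma.ι D ⟨p, f⟩).f.f y, ?_⟩
    have he : Sigma.ι D ⟨p, f⟩ ≫ e = f := Sigma.ι_desc _ _
    exact congrArg (fun k : countableCoalgebra F p ⟶ Z => k.f.f y) he
  · refine hq _ _ _ (pushout.inr e g) ?_
    change (g ≫ pushout.inr e g).f.f x = (g ≫ pushout.inr e g).f.f y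
    rw [← pushout.condition]
    exact congrArg (pushout.inl e g).f.f hxy

theorem hasTerminal_coalgebra [PreservesFilteredColimits T.toFunctor]
    [PreservesFilteredColimits F] (hsurj : PreservesSurjections F) :
    HasTerminal (Endofunctor.Coalgebra F) := by
  obtain ⟨N, hN⟩ := exists_weakly_terminal hsurj
  have : HasInitial (Endofunctor.Coalgebra F)ᵒᵖ :=
    hasInitial_of_weakly_initial_and_hasWideEqualizers (T := Opposite.op N)
      fun Z => ⟨(hN Z.unop).some.op⟩
  exact hasTerminal_of_hasInitial_op

end Terminal

end AlgebraicCoalgebra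

/-! ### Zig-zags -/

namespace ZigZag

variable {C : Type w} [Category.{v} C] (U : C ⥤ Type u)

/-- Two elements of the category of elements of `U` are related by some zig-zag. -/
def Linked (a b : Σ Z, U.obj Z) : Prop := ∃ p : ZigZag a.1 b.1, p.Relates U a.2 b.2

variable {U}

theorem Linked.trans {a b c : Σ Z, U.obj Z} (h : Linked U a b) (h' : Linked U b c) :
    Linked U a c := by
  obtain ⟨a, x⟩ := a
  obtain ⟨b, y⟩ := b
  obtain ⟨c, z⟩ := c
  obtain ⟨p, hp⟩ := h
  dsimp only at p hp
  induction p with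
  | nil Z =>
    obtain rfl : x = y := hp
    exact h'
  | cons f g p ih =>
    obtain ⟨x₁, x₂, h₁, h₂, hp⟩ := hp
    obtain ⟨p', hp'⟩ := ih x₂ y h' hp
    exact ⟨.cons f g p', x₁, x₂, h₁, h₂, hp'⟩

theorem Linked.of_cospan {a b : Σ Z, U.obj Z} {Z : C} (f : a.1 ⟶ Z) (g : b.1 ⟶ Z)
    (h : U.map f a.2 = U.map g b.2) : Linked U a b :=
  ⟨.cons f g (.nil _), _, _, rfl, h.symm, rfl⟩

theorem Linked.symm {a b : Σ Z, U.obj Z} (h : Linked U a b) : Linked U b a := by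
  obtain ⟨a, x⟩ := a
  obtain ⟨b, y⟩ := b
  obtain ⟨p, hp⟩ := h
  dsimp only at p hp
  induction p with
  | nil Z =>
    obtain rfl : x = y := hp
    exact ⟨.nil _, rfl⟩
  | cons f g p ih =>
    obtain ⟨x₁, x₂, h₁, h₂, hp⟩ := hp
    exact (ih x₂ y hp).trans (Linked.of_cospan g f (h₂.trans h₁.symm))

theorem linked_of_eqvGen {a b : Σ Z, U.obj Z} (h : Relation.EqvGen U.ColimitTypeRel a b) :
    Linked U a b := by
  induction h with
  | rel a b h =>
    obtain ⟨f, hf⟩ := h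
    exact Linked.of_cospan f (𝟙 _) (by rw [← hf]; simp)
  | refl a => exact ⟨.nil _, rfl⟩
  | symm a b _ ih => exact ih.symm
  | trans a b c _ _ ih ih' => exact ih.trans ih'

/-- Elements that become equal in the colimit of `U` are related by a zig-zag. -/
theorem exists_relates {t : Cocone U} (ht : IsColimit t) {Z W : C} {z : U.obj Z} {z' : U.obj W}
    (h : t.ι.app Z z = t.ι.app W z') : ∃ p : ZigZag Z W, p.Relates U z z' := by
  have h' := ((Types.isColimit_iff_coconeTypesIsColimit t).1 ⟨ht⟩).bijective.1
    (a₁ := U.ιColimitType Z z) (a₂ := U.ιColimitType W z') h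
  exact linked_of_eqvGen ((U.ιColimitType_eq_iff _ _).1 h')

/-- Elements that are related by a zig-zag are identified by every cocone. -/
theorem Relates.ι_eq {Z W : C} {p : ZigZag Z W} {z : U.obj Z} {z' : U.obj W}
    (h : p.Relates U z z') (t : Cocone U) : t.ι.app Z z = t.ι.app W z' := by
  induction p with
  | nil Z =>
    obtain rfl : z = z' := h
    rfl
  | cons f g p ih =>
    obtain ⟨z₁, z₂, rfl, h₂, hp⟩ := h
    rw [← ih hp]
    have e₁ := ConcreteCategory.congr_hom (t.w f) z
    have e₂ := ConcreteCategory.congr_hom (t.w g) z₂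
    exact e₁.symm.trans ((congrArg _ h₂.symm).trans e₂)

end ZigZag

namespace AlgebraicCoalgebra

/-! ### Turning arbitrary elements into generators -/

section Generators

variable {T : Monad (Type u)} {F : T.Algebra ⥤ T.Algebra}

/-- The retraction of `T (X + 1)` onto `T X` which maps the additional generator to `z`. -/
def adjoinRetraction {X : Type u} (z : (T.free.obj X).A) :
    T.free.obj (X ⊕ PUnit.{u + 1}) ⟶ T.free.obj X :=
  freeLift (Sum.elim (T.η.app X) fun _ => z)

theorem inl_adjoinRetraction {X : Type u} (z : (T.free.obj X).A) :
    T.free.map (↾Sum.inl) ≫ adjoinRetraction z = 𝟙 _ :=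
  (free_map_freeLift _ _).trans (free_hom_ext fun x => freeLift_η _ x)

/-- The coalgebra `c` with an additional generator that behaves like the element `z`. -/
def adjoin (c : FfgCoalgebra F) (z : (T.free.obj c.X).A) : FfgCoalgebra F where
  X := c.X ⊕ PUnit.{u + 1}
  finite := by
    have := c.finite
    infer_instance
  str := adjoinRetraction z ≫ c.str ≫ F.map (T.free.map (↾Sum.inl))

/-- The retraction is a morphism of coalgebras, since it splits the inclusion of `TX`. -/
def adjoinHom (c : FfgCoalgebra F) (z : (T.free.obj c.X).A) :
    (adjoin c z).toCoalgebra ⟶ c.toCoalgebra where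
  f := adjoinRetraction z
  h := by
    change (adjoinRetraction z ≫ c.str ≫ F.map (T.free.map (↾Sum.inl))) ≫
      F.map (adjoinRetraction z) = adjoinRetraction z ≫ c.str
    rw [Category.assoc, Category.assoc, ← F.map_comp, inl_adjoinRetraction, F.map_id,
      Category.comp_id]

theorem adjoinHom_generator (c : FfgCoalgebra F) (z : (T.free.obj c.X).A) :
    (adjoinHom c z).f.f (generator (adjoin c z) (.inr PUnit.unit)) = z :=
  freeLift_η _ _

end Generators

end AlgebraicCoalgebra

open AlgebraicCoalgebra in
/-- `φ` is the colimit of all coalgebras with free finitely generated carrier, `N` is the final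
coalgebra, and `hN.from φ.pt` is the unique coalgebra morphism between them. -/
theorem theorem5p3 {T : Monad (Type u)} (hT : PreservesFilteredColimits T.toFunctor)
    (F : T.Algebra ⥤ T.Algebra) (hF : PreservesFilteredColimits F)
    (hsurj : PreservesSurjections F) :
    HasColimit (ffgInclusion F) ∧ HasTerminal (Endofunctor.Coalgebra F) ∧
      ∀ (φ : Cocone (ffgInclusion F)) (_ : IsColimit φ)
        (N : Endofunctor.Coalgebra F) (hN : IsTerminal N),
        IsProper F ↔ Mono (hN.from φ.pt).f := by
  refine ⟨inferInstance, hasTerminal_coalgebra hsurj, fun φ hφ N hN => ?_⟩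
  have := preservesColimit_forget F
  let t := (Endofunctor.Coalgebra.forget F ⋙ T.forget).mapCocone φ
  have ht : IsColimit (C := Type u) (F := ffgForget F) t := isColimitOfPreserves _ hφ
  constructor
  · intro hP
    suffices h : Function.Injective (hN.from φ.pt).f.f by
      have : Mono (hN.from φ.pt).f.f := (mono_iff_injective _).2 h
      exact T.algebra_mono_of_mono _
    intro a b hab
    obtain ⟨c, z, rfl⟩ := Types.jointly_surjective_of_isColimit ht a
    obtain ⟨d, w, rfl⟩ := Types.jointly_surjective_of_isColimit ht b
    -- properness speaks about generators only, so `z` and `w` are replaced by new generators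
    let c' : CoalgFfg F := adjoin c z
    let d' : CoalgFfg F := adjoin d w
    let r : c' ⟶ c := InducedCategory.homMk (adjoinHom c z)
    let r' : d' ⟶ d := InducedCategory.homMk (adjoinHom d w)
    have h₁ : (φ.ι.app c').f.f (generator (adjoin c z) (.inr PUnit.unit)) =
        (φ.ι.app c).f.f z := by
      rw [← φ.w r]
      exact congrArg (φ.ι.app c).f.f (adjoinHom_generator c z)
    have h₂ : (φ.ι.app d').f.f (generator (adjoin d w) (.inr PUnit.unit)) =
        (φ.ι.app d).f.f w := by
      rw [← φ.w r']
      exact congrArg (φ.ι.app d).f.f (adjoinHom_generator d w)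
    obtain ⟨p, hp⟩ := hP c' d' (.inr PUnit.unit) (.inr PUnit.unit)
      ⟨N, φ.ι.app c' ≫ hN.from φ.pt, φ.ι.app d' ≫ hN.from φ.pt, by
        refine Eq.trans (congrArg (hN.from φ.pt).f.f h₁) (hab.trans ?_)
        exact congrArg (hN.from φ.pt).f.f h₂.symm⟩
    exact h₁.symm.trans ((hp.ι_eq t).trans h₂)
  · intro hm c d x y hxy
    obtain ⟨e, f, g, hfg⟩ := hxy
    have hinj : Function.Injective (hN.from φ.pt).f.f :=
      (mono_iff_injective _).1 (T.forget.map_mono (hN.from φ.pt).f)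
    refine ZigZag.exists_relates ht (hinj ?_)
    have e₁ : φ.ι.app c ≫ hN.from φ.pt = f ≫ hN.from e := hN.hom_ext _ _
    have e₂ : φ.ι.app d ≫ hN.from φ.pt = g ≫ hN.from e := hN.hom_ext _ _
    have h₁ := congrArg (fun k : FfgCoalgebra.toCoalgebra c ⟶ N => k.f.f (generator c x)) e₁
    have h₂ := congrArg (fun k : FfgCoalgebra.toCoalgebra d ⟶ N => k.f.f (generator d y)) e₂
    exact h₁.trans ((congrArg (hN.from e).f.f hfg).trans h₂.symm)
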